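/- Conventions. All algebras are algebras of complex matrices: a $*$-algebra $\mathscr{A}\subseteq\mathbb{C}^{n\times n}$ is a linear subspace closed under products and adjoints (not necessarily containing $I$). A linear map $\varphi:\mathscr{A}_1\to\mathscr{A}_2$ between $*$-algebras is CP if for every $k$ its entrywise application to $k\times k$ matrices over $\mathscr{A}_1$ preserves positive semidefiniteness, and CPTP if moreover ${\rm tr}\,\varphi(X)={\rm tr}\,X$ for all $X\in\mathscr{A}_1$. A density operator is a positive semidefinite matrix of trace one. A QHM model $(\mathscr{A},\mathscr{Y},\mathcal{A},\mathcal{C},\mathfrak{S})$ consists of a $*$-algebra $\mathscr{A}$ (the state space), a complex vector space $\mathscr{Y}$, a CPTP map $\mathcal{A}:\mathscr{A}\to\mathscr{A}$, a linear map $\mathcal{C}:\mathscr{A}\to\mathscr{Y}$ and a set $\mathfrak{S}$ of density operators in $\mathscr{A}$. A QHM model $(\check{\mathscr{A}},\mathscr{Y},\check{\mathcal{A}},\check{\mathcal{C}},\check{\mathfrak{S}})$ together with a CPTP map $\Phi:\mathscr{A}\to\check{\mathscr{A}}$ solves the CPTP model-reduction problem for it if $\dim\check{\mathscr{A}}\le\dim\mathscr{A}$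 and $\mathcal{C}[\mathcal{A}^t[\rho_0]]=\check{\mathcal{C}}[\check{\mathcal{A}}^t[\Phi[\rho_0]]]$ for all $\rho_0\in\mathfrak{S}$ and $t\ge 0$. A conditional expectation onto a $*$-algebra $\mathscr{B}\ni I$ is a CP linear map $\mathbb{E}:\mathbb{C}^{n\times n}\to\mathscr{B}$ with $\mathbb{E}(I)=I$ and $\mathbb{E}(AX)=A\,\mathbb{E}(X)$ for $A\in\mathscr{B}$, $X\in\mathbb{C}^{n\times n}$; its dual $\mathbb{J}=\mathbb{E}^\dagger$ with respect to $\langle X,Y\rangle={\rm tr}(X^\dagger Y)$ is called a state extension for $\mathscr{B}$. Statement. Let $(\mathscr{A},\mathscr{Y},\mathcal{A},\mathcal{C},\mathfrak{S})$ be a QHM model, let $\mathscr{B}\subseteq\mathscr{A}$ be a unital $*$-algebra ($I\in\mathscr{B}$), and let $\mathbb{J}$ be a state extension for $\mathscr{B}$ that maps $\mathscr{A}$ into $\mathscr{A}$ (so that $\mathbb{J}\mathcal{A}\mathbb{J}$ makes sense on $\mathscr{A}$); from now on $\mathbb{J}$ is regarded as a map $\mathscr{A}\to\mathscr{A}$.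 Let $$\mathscr{B}=U\Big(\bigoplus_\ell \mathfrak{B}(\mathcal{H}_{S,\ell})\otimes I_{F,\ell}\Big)U^\dagger$$ be a block (Wedderburn) decomposition, with $U$ unitary and all $\mathcal{H}_{S,\ell},\mathcal{H}_{F,\ell}$ finite-dimensional and nonzero, let $V_\ell$ be the $\ell$-th block of $U^\dagger$, and let $\check{\mathscr{B}}_0=\bigoplus_\ell\mathfrak{B}(\mathcal{H}_{S,\ell})$. Then: 1. There are CPTP maps $\mathcal{R}:\mathscr{A}\to\check{\mathscr{B}}_0$ and $\mathcal{J}:\check{\mathscr{B}}_0\to\mathscr{A}$ with $\mathbb{J}=\mathcal{J}\mathcal{R}$ and $\mathcal{R}(X)=\bigoplus_\ell{\rm tr}_{\mathcal{H}_{F,\ell}}(V_\ell XV_\ell^\dagger)$. 2. Let $\mathcal{R}:\mathscr{A}\to\check{\mathscr{B}}_0$, $\mathcal{J}:\check{\mathscr{B}}_0\to\mathscr{A}$ be any CPTP maps with $\mathbb{J}=\mathcal{J}\mathcal{R}$, and suppose that $$\mathcal{C}\mathcal{A}^t[\rho_0]=\mathcal{C}\,\mathbb{J}(\mathbb{J}\mathcal{A}\mathbb{J})^t\,\mathbb{J}[\rho_0]\qquad\text{for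 all } t\ge 0,\ \rho_0\in\mathfrak{S}.$$ Then $({\rm Im}\,\mathcal{R},\mathscr{Y},\mathcal{R}\mathcal{A}\mathcal{J},\mathcal{C}\mathcal{J},\mathcal{R}\mathfrak{S})$ is a QHM model (in particular ${\rm Im}\,\mathcal{R}$ is a $*$-algebra, $\mathcal{R}\mathcal{A}\mathcal{J}$ restricts to a CPTP map on it, and $\mathcal{R}\mathfrak{S}$ consists of density operators), and together with $\Phi=\mathcal{R}$ it solves the CPTP model-reduction problem for $(\mathscr{A},\mathscr{Y},\mathcal{A},\mathcal{C},\mathfrak{S})$. -/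

import Mathlib

open scoped ComplexOrder Kronecker Matrix

/-- Density operators: positive semidefinite (hence Hermitian) matrices of trace one. -/
def IsDensity {n : Type*} [Fintype n] (ρ : Matrix n n ℂ) : Prop :=
  ρ.PosSemidef ∧ ρ.trace = 1

/-- Complete positivity of a linear map `φ : A₁ → A₂` between `*`-algebras of matrices:
for every `k`, the entrywise application of `φ` to `k × k` matrices over `A₁` (read as complex
matrices indexed by `Fin k × n`) preserves positive semidefiniteness. -/
def IsCompletelyPositive {n m : Type*} [Fintype n] [Fintype m]
    {A₁ : NonUnitalStarSubalgebra ℂ (Matrix n n ℂ)}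
    {A₂ : NonUnitalStarSubalgebra ℂ (Matrix m m ℂ)} (φ : A₁ →ₗ[ℂ] A₂) : Prop :=
  ∀ (k : ℕ) (X : Matrix (Fin k) (Fin k) A₁),
    (Matrix.comp (Fin k) (Fin k) n n ℂ (X.map fun a => (a : Matrix n n ℂ))).PosSemidef →
    (Matrix.comp (Fin k) (Fin k) m m ℂ (X.map fun a => (φ a : Matrix m m ℂ))).PosSemidef

/-- Completely positive and trace preserving linear maps. -/
structure IsCPTP {n m : Type*} [Fintype n] [Fintype m]
    {A₁ : NonUnitalStarSubalgebra ℂ (Matrix n n ℂ)}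
    {A₂ : NonUnitalStarSubalgebra ℂ (Matrix m m ℂ)} (φ : A₁ →ₗ[ℂ] A₂) : Prop where
  completelyPositive : IsCompletelyPositive φ
  trace_preserving : ∀ X : A₁, (φ X : Matrix m m ℂ).trace = (X : Matrix n n ℂ).trace

/-- A discrete-time quantum hidden Markov model: a `*`-algebra (not necessarily containing the
identity matrix) as state space, a CPTP evolution, a linear output map and a set of initial
density operators in the algebra. -/
structure QHM (n : Type*) [Fintype n] (Y : Type*) [AddCommGroup Y] [Module ℂ Y] where
  space : NonUnitalStarSubalgebra ℂ (Matrix n n ℂ)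
  dyn : Module.End ℂ space
  dyn_cptp : IsCPTP dyn
  out : space →ₗ[ℂ] Y
  init : Set space
  init_density : ∀ ρ ∈ init, IsDensity (ρ : Matrix n n ℂ)

/-- The model `M'` together with the map `Φ` solves the model reduction problem for `M`. -/
structure SolvesReduction {n m : Type*} [Fintype n] [Fintype m]
    {Y : Type*} [AddCommGroup Y] [Module ℂ Y]
    (M : QHM n Y) (M' : QHM m Y) (Φ : M.space →ₗ[ℂ] M'.space) : Prop where
  dim_le : Module.finrank ℂ M'.space ≤ Module.finrank ℂ M.space
  cptp : IsCPTP Φ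
  same_output : ∀ ρ ∈ M.init, ∀ t : ℕ,
    M.out ((M.dyn ^ t) ρ) = M'.out ((M'.dyn ^ t) (Φ ρ))

/-- Conditional expectations from the algebra of all matrices onto `B`. The condition
`map_one` forces `B` to contain the identity. -/
structure IsConditionalExpectation {n : Type*} [Fintype n] [DecidableEq n]
    {B : NonUnitalStarSubalgebra ℂ (Matrix n n ℂ)}
    (E : (⊤ : NonUnitalStarSubalgebra ℂ (Matrix n n ℂ)) →ₗ[ℂ] B) : Prop where
  completelyPositive : IsCompletelyPositive E
  map_one : (E ⟨1, trivial⟩ : Matrix n n ℂ) = 1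
  map_mul : ∀ (a : B) (X : Matrix n n ℂ),
    (E ⟨(a : Matrix n n ℂ) * X, trivial⟩ : Matrix n n ℂ)
      = (a : Matrix n n ℂ) * (E ⟨X, trivial⟩ : Matrix n n ℂ)

/-- `𝕁 : A → A` is (the restriction to `A` of) a state extension for `B`, that is, of the
Hilbert-Schmidt dual of a conditional expectation `E` onto `B`. As `X` ranges over all matrices,
`𝕁 ρ` is exactly the value at `ρ` of the dual of `E`. -/
def IsStateExtension {n : Type*} [Fintype n] [DecidableEq n]
    (A B : NonUnitalStarSubalgebra ℂ (Matrix n n ℂ)) (𝕁 : Module.End ℂ A) : Prop :=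
  ∃ E : (⊤ : NonUnitalStarSubalgebra ℂ (Matrix n n ℂ)) →ₗ[ℂ] B,
    IsConditionalExpectation E ∧
    ∀ (ρ : A) (X : Matrix n n ℂ),
      ((𝕁 ρ : Matrix n n ℂ)ᴴ * X).trace
        = ((ρ : Matrix n n ℂ)ᴴ * (E ⟨X, trivial⟩ : Matrix n n ℂ)).trace

/-- A block decomposition `B = U (⨁ ℓ, M_{s ℓ}(ℂ) ⊗ I_{f ℓ}) U†` of a unital `*`-algebra, along
a unitary identification of the underlying space with `⨁ ℓ, ℂ^{s ℓ} ⊗ ℂ^{f ℓ}`, all of whose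
factors are nonzero. -/
structure WedderburnDecomposition {n ι : Type*} [Fintype n] [DecidableEq n]
    [Fintype ι] [DecidableEq ι] (s f : ι → Type*)
    [∀ ℓ, Fintype (s ℓ)] [∀ ℓ, DecidableEq (s ℓ)] [∀ ℓ, Fintype (f ℓ)] [∀ ℓ, DecidableEq (f ℓ)]
    (B : NonUnitalStarSubalgebra ℂ (Matrix n n ℂ)) where
  nonempty_s : ∀ ℓ, Nonempty (s ℓ)
  nonempty_f : ∀ ℓ, Nonempty (f ℓ)
  U : Matrix n (Σ ℓ, s ℓ × f ℓ) ℂ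
  conjTranspose_mul_self : Uᴴ * U = 1
  mul_conjTranspose_self : U * Uᴴ = 1
  mem_iff : ∀ X : Matrix n n ℂ, X ∈ B ↔ ∃ b : ∀ ℓ, Matrix (s ℓ) (s ℓ) ℂ,
    X = U * Matrix.blockDiagonal' (fun ℓ => b ℓ ⊗ₖ (1 : Matrix (f ℓ) (f ℓ) ℂ)) * Uᴴ

/-- The algebra `⨁ ℓ, M_{s ℓ}(ℂ)` of block diagonal matrices. -/
def blockAlgebra {ι : Type*} [Fintype ι] [DecidableEq ι] (s : ι → Type*)
    [∀ ℓ, Fintype (s ℓ)] [∀ ℓ, DecidableEq (s ℓ)] :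
    NonUnitalStarSubalgebra ℂ (Matrix (Σ ℓ, s ℓ) (Σ ℓ, s ℓ) ℂ) where
  carrier := Set.range fun b : (∀ ℓ, Matrix (s ℓ) (s ℓ) ℂ) => Matrix.blockDiagonal' b
  add_mem' := by
    rintro _ _ ⟨a, rfl⟩ ⟨b, rfl⟩
    exact ⟨a + b, Matrix.blockDiagonal'_add a b⟩
  zero_mem' := ⟨0, Matrix.blockDiagonal'_zero⟩
  mul_mem' := by
    rintro _ _ ⟨a, rfl⟩ ⟨b, rfl⟩
    exact ⟨fun ℓ => a ℓ * b ℓ, Matrix.blockDiagonal'_mul a b⟩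
  smul_mem' := by
    rintro c _ ⟨a, rfl⟩
    exact ⟨c • a, Matrix.blockDiagonal'_smul c a⟩
  star_mem' := by
    rintro _ ⟨a, rfl⟩
    exact ⟨fun ℓ => (a ℓ)ᴴ, (Matrix.blockDiagonal'_conjTranspose a).symm⟩

/-- The reduction `X ↦ ⨁ ℓ, tr_{f ℓ} (V_ℓ X V_ℓ†)`, where `V_ℓ` is the `ℓ`-th block of `U†`. -/
def WedderburnDecomposition.partialTraces {n ι : Type*} [Fintype n] [DecidableEq n]
    [Fintype ι] [DecidableEq ι] {s f : ι → Type*}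
    [∀ ℓ, Fintype (s ℓ)] [∀ ℓ, DecidableEq (s ℓ)] [∀ ℓ, Fintype (f ℓ)] [∀ ℓ, DecidableEq (f ℓ)]
    {B : NonUnitalStarSubalgebra ℂ (Matrix n n ℂ)} (W : WedderburnDecomposition s f B)
    (X : Matrix n n ℂ) : Matrix (Σ ℓ, s ℓ) (Σ ℓ, s ℓ) ℂ :=
  Matrix.blockDiagonal' fun ℓ => Matrix.of fun i j =>
    ∑ k, (W.Uᴴ * X * W.U) ⟨ℓ, (i, k)⟩ ⟨ℓ, (j, k)⟩

/-- A factorization `𝕁 = 𝒥 ∘ ℛ` of a map `𝕁 : A → A` into CPTP maps `ℛ : A → Ǎ` and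
`𝒥 : Ǎ → A`, where `Ǎ = ⨁ ℓ, M_{s ℓ}(ℂ)`. -/
structure IsCPTPFactorization {n ι : Type*} [Fintype n]
    [Fintype ι] [DecidableEq ι] {s : ι → Type*} [∀ ℓ, Fintype (s ℓ)] [∀ ℓ, DecidableEq (s ℓ)]
    {A : NonUnitalStarSubalgebra ℂ (Matrix n n ℂ)} (𝕁 : Module.End ℂ A)
    (R : A →ₗ[ℂ] blockAlgebra s) (J : blockAlgebra s →ₗ[ℂ] A) : Prop where
  reduction_cptp : IsCPTP R
  injection_cptp : IsCPTP J
  factor : 𝕁 = J ∘ₗ R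

/-! The partial traces are the Hilbert-Schmidt dual of `lift`, the unital completely positive map ⨁
b ↦ U (⨁ b ⊗ 1) U†, hence CPTP. Dividing by dim F_ℓ turns `lift` into a CPTP section `injection`. As
𝕁 X depends only on the functional tr(X† ·) on B, and `injection` ∘ `reduction` preserves that
functional, 𝕁 = (𝕁 ∘ `injection`) ∘ `reduction`.

For an arbitrary factorization 𝕁 = J R, injectivity of 𝕁 on B makes J (R ∘ `injection`) injective.
In finite dimension R ∘ `injection` is then bijective, so R is onto and J is injective. Idempotence
J R J R = J R now gives R J = 1: the image of R is the whole block algebra, and R intertwines 𝕁 A 𝕁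
with R A J. -/

namespace Matrix

/-- Complete positivity of a map between full matrix algebras. -/
def IsCPMap {n m : Type*} [Fintype n] [Fintype m] (φ : Matrix n n ℂ → Matrix m m ℂ) : Prop :=
  ∀ (k : ℕ) (X : Matrix (Fin k) (Fin k) (Matrix n n ℂ)),
    (comp (Fin k) (Fin k) n n ℂ X).PosSemidef →
    (comp (Fin k) (Fin k) m m ℂ (X.map φ)).PosSemidef

/-! ### Complete positivity and Hilbert-Schmidt duality on full matrix algebras -/

section CPMap

variable {n m l : Type*} [Fintype n] [Fintype m] [Fintype l]

theorem IsCPMap.comp {ψ : Matrix m m ℂ → Matrix l l ℂ} {φ : Matrix n n ℂ → Matrix m m ℂ}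
    (hψ : IsCPMap ψ) (hφ : IsCPMap φ) : IsCPMap fun X => ψ (φ X) :=
  fun k X hX => hψ k (X.map φ) (hφ k X hX)

theorem isCPMap_conj (K : Matrix m n ℂ) : IsCPMap fun X : Matrix n n ℂ => K * X * Kᴴ := by
  intro k X hX
  have h := hX.mul_mul_conjTranspose_same ((1 : Matrix (Fin k) (Fin k) ℂ) ⊗ₖ K)
  convert h using 1
  ext ⟨i, a⟩ ⟨j, b⟩
  simp [mul_apply, comp_apply, Fintype.sum_prod_type, one_apply, Finset.sum_mul,
    apply_ite (starRingEnd ℂ)]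

/-- Schur multiplication by the indicator of the fibres of `p` is completely positive. -/
theorem isCPMap_submatrix_fibre {α : Type*} [DecidableEq α] [Fintype α] (q : m → n) (p : m → α) :
    IsCPMap fun X : Matrix n n ℂ => of fun d d' => if p d = p d' then X (q d) (q d') else 0 := by
  intro k X hX
  -- Schur product theorem: the mask is the identity pulled back along `p`, hence positive
  -- semidefinite.
  have h := (hX.submatrix (fun a : Fin k × m => (a.1, q a.2))).hadamard
    ((PosSemidef.one (n := α) (R := ℂ)).submatrix (fun a : Fin k × m => p a.2))
  refine Eq.mp (congrArg PosSemidef ?_) h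
  ext ⟨i, a⟩ ⟨j, b⟩
  simp [comp_apply, one_apply]

theorem PosSemidef.trace_mul_nonneg {A B : Matrix n n ℂ} (hA : A.PosSemidef) (hB : B.PosSemidef) :
    0 ≤ (A * B).trace := by
  obtain ⟨_, v, rfl⟩ := posSemidef_iff_eq_sum_vecMulVec.mp hB
  simp only [Finset.mul_sum, trace_sum, mul_vecMulVec, trace_vecMulVec]
  refine Finset.sum_nonneg fun i _ => ?_
  rw [dotProduct_comm]
  exact hA.dotProduct_mulVec_nonneg (v i)

/-- Over ℂ a real-valued quadratic form already forces the matrix to be Hermitian. -/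
theorem posSemidef_of_dotProduct_mulVec_nonneg {A : Matrix n n ℂ}
    (h : ∀ v : n → ℂ, 0 ≤ star v ⬝ᵥ (A *ᵥ v)) : A.PosSemidef := by
  classical
  rw [← isPositive_toEuclideanLin_iff, LinearMap.isPositive_iff_complex]
  intro x
  have hx := h x.ofLp
  have e : inner ℂ (A.toEuclideanLin x) x = star (star x.ofLp ⬝ᵥ (A *ᵥ x.ofLp)) := by
    rw [EuclideanSpace.inner_eq_star_dotProduct, star_dotProduct, star_star, dotProduct_comm]
    rfl
  rw [Complex.nonneg_iff] at hx
  rw [e]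
  constructor
  · apply Complex.ext <;> simp [← hx.2]
  · simpa using hx.1

theorem trace_conjTranspose_comp_mul_comp {k : Type*} [Fintype k] (X Y : Matrix k k (Matrix n n ℂ)) :
    ((comp k k n n ℂ X)ᴴ * comp k k n n ℂ Y).trace = ∑ i, ∑ j, ((X i j)ᴴ * Y i j).trace := by
  simp only [trace, diag, mul_apply, conjTranspose_apply, comp_apply, Fintype.sum_prod_type]
  conv_rhs => rw [Finset.sum_comm]
  refine Finset.sum_congr rfl fun j _ => ?_
  rw [Finset.sum_comm]

/-- The Hilbert-Schmidt dual of a completely positive map is completely positive. -/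
theorem posSemidef_comp_of_dual {k : ℕ} {ψ : Matrix m m ℂ → Matrix n n ℂ} (hψ : IsCPMap ψ)
    {X : Matrix (Fin k) (Fin k) (Matrix n n ℂ)} {Z : Matrix (Fin k) (Fin k) (Matrix m m ℂ)}
    (hX : (comp (Fin k) (Fin k) n n ℂ X).PosSemidef)
    (h : ∀ i j y, ((Z i j)ᴴ * y).trace = ((X i j)ᴴ * ψ y).trace) :
    (comp (Fin k) (Fin k) m m ℂ Z).PosSemidef := by
  rw [← posSemidef_conjTranspose_iff]
  -- The form at `v` is the trace pairing with v v†; duality moves it to a pairing of two positive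
  -- semidefinite matrices.
  refine posSemidef_of_dotProduct_mulVec_nonneg fun v => ?_
  have hv := posSemidef_vecMulVec_self_star v
  let Y := (comp (Fin k) (Fin k) m m ℂ).symm (vecMulVec v (star v))
  have hY : comp (Fin k) (Fin k) m m ℂ Y = vecMulVec v (star v) := Equiv.apply_symm_apply _ _
  rw [← hY] at hv
  have e : star v ⬝ᵥ ((comp (Fin k) (Fin k) m m ℂ Z)ᴴ *ᵥ v)
      = ((comp (Fin k) (Fin k) n n ℂ X)ᴴ * comp (Fin k) (Fin k) n n ℂ (Y.map ψ)).trace := by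
    rw [trace_conjTranspose_comp_mul_comp]
    simp only [map_apply, ← h]
    rw [← trace_conjTranspose_comp_mul_comp, hY, mul_vecMulVec, trace_vecMulVec, dotProduct_comm]
  rw [e]
  exact hX.conjTranspose.trace_mul_nonneg (hψ k Y hv)

end CPMap

end Matrix

instance NonUnitalStarSubalgebra.finiteDimensional_matrix {n : Type*} [Fintype n]
    (A : NonUnitalStarSubalgebra ℂ (Matrix n n ℂ)) : FiniteDimensional ℂ A :=
  Module.Finite.of_injective
    ({ toFun := Subtype.val, map_add' := fun _ _ => rfl, map_smul' := fun _ _ => rfl } :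
      A →ₗ[ℂ] Matrix n n ℂ) Subtype.val_injective

/-! ### CPTP maps between *-algebras -/

section IsCPTP

variable {n m l : Type*} [Fintype n] [Fintype m] [Fintype l]
  {A₁ : NonUnitalStarSubalgebra ℂ (Matrix n n ℂ)}
  {A₂ : NonUnitalStarSubalgebra ℂ (Matrix m m ℂ)}
  {A₃ : NonUnitalStarSubalgebra ℂ (Matrix l l ℂ)}

theorem IsCPTP.comp {ψ : A₂ →ₗ[ℂ] A₃} {φ : A₁ →ₗ[ℂ] A₂} (hψ : IsCPTP ψ) (hφ : IsCPTP φ) :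
    IsCPTP (ψ ∘ₗ φ) where
  completelyPositive k X hX :=
    hψ.completelyPositive k (X.map φ) (hφ.completelyPositive k X hX)
  trace_preserving X := (hψ.trace_preserving (φ X)).trans (hφ.trace_preserving X)

theorem IsCompletelyPositive.of_isCPMap {φ : A₁ →ₗ[ℂ] A₂} {ψ : Matrix n n ℂ → Matrix m m ℂ}
    (hψ : Matrix.IsCPMap ψ) (h : ∀ X : A₁, (φ X : Matrix m m ℂ) = ψ X) :
    IsCompletelyPositive φ := by
  intro k X hX
  have := hψ k (X.map fun a => (a : Matrix n n ℂ)) hX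
  simp only [h]
  exact this

theorem IsCompletelyPositive.of_dual {φ : A₁ →ₗ[ℂ] A₂} {ψ : Matrix m m ℂ → Matrix n n ℂ}
    (hψ : Matrix.IsCPMap ψ)
    (h : ∀ (X : A₁) (y : Matrix m m ℂ),
      ((φ X : Matrix m m ℂ)ᴴ * y).trace = ((X : Matrix n n ℂ)ᴴ * ψ y).trace) :
    IsCompletelyPositive φ :=
  fun _ X hX => Matrix.posSemidef_comp_of_dual hψ hX fun i j y => h (X i j) y

theorem IsCPTP.isDensity {φ : A₁ →ₗ[ℂ] A₂} (hφ : IsCPTP φ) {ρ : A₁}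
    (hρ : IsDensity (ρ : Matrix n n ℂ)) : IsDensity (φ ρ : Matrix m m ℂ) := by
  refine ⟨?_, (hφ.trace_preserving ρ).trans hρ.2⟩
  have h := hφ.completelyPositive 1 (fun _ _ => ρ) (hρ.1.submatrix Prod.snd)
  exact h.submatrix fun a => (0, a)

end IsCPTP

/-! ### State extensions -/

section StateExtension

variable {n : Type*} [Fintype n] [DecidableEq n] {A B : NonUnitalStarSubalgebra ℂ (Matrix n n ℂ)}

theorem IsConditionalExpectation.apply_of_mem
    {E : (⊤ : NonUnitalStarSubalgebra ℂ (Matrix n n ℂ)) →ₗ[ℂ] B}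
    (hE : IsConditionalExpectation E) {X : Matrix n n ℂ} (hX : X ∈ B) :
    (E ⟨X, trivial⟩ : Matrix n n ℂ) = X := by
  have h := hE.map_mul ⟨X, hX⟩ 1
  simpa [hE.map_one] using h

variable {𝕁 : Module.End ℂ A}

theorem IsStateExtension.isCPTP (h : IsStateExtension A B 𝕁) : IsCPTP 𝕁 := by
  obtain ⟨E, hE, hd⟩ := h
  refine ⟨.of_dual (ψ := fun X => E ⟨X, trivial⟩) ?_ hd, fun X => ?_⟩
  · intro k X hX
    exact hE.completelyPositive k (X.map fun a => ⟨a, trivial⟩) hX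
  · have := hd X 1
    rw [hE.map_one] at this
    simpa only [Matrix.trace_conjTranspose, mul_one, star_inj] using this

/-- Dual to E ∘ E = E, since E fixes B. -/
theorem IsStateExtension.apply_apply (h : IsStateExtension A B 𝕁) (X : A) : 𝕁 (𝕁 X) = 𝕁 X := by
  obtain ⟨E, hE, hd⟩ := h
  apply Subtype.ext
  apply Matrix.conjTranspose_injective
  rw [Matrix.ext_iff_trace_mul_right]
  intro Y
  rw [hd, hd, hd, hE.apply_of_mem (SetLike.coe_mem _)]

theorem IsStateExtension.apply_congr (h : IsStateExtension A B 𝕁) {X Y : A}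
    (hXY : ∀ b ∈ B, ((X : Matrix n n ℂ)ᴴ * b).trace = ((Y : Matrix n n ℂ)ᴴ * b).trace) :
    𝕁 X = 𝕁 Y := by
  obtain ⟨E, hE, hd⟩ := h
  apply Subtype.ext
  apply Matrix.conjTranspose_injective
  rw [Matrix.ext_iff_trace_mul_right]
  intro Z
  rw [hd, hd, hXY _ (SetLike.coe_mem _)]

/-- E fixes X, so pairing 𝕁 X with X gives tr(X† X). -/
theorem IsStateExtension.eq_zero_of_mem (h : IsStateExtension A B 𝕁) {X : A}
    (hX : (X : Matrix n n ℂ) ∈ B) (h0 : 𝕁 X = 0) : X = 0 := by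
  obtain ⟨E, hE, hd⟩ := h
  have := hd X X
  rw [h0, hE.apply_of_mem hX] at this
  apply Subtype.ext
  exact Matrix.trace_conjTranspose_mul_self_eq_zero_iff.mp (by simpa using this.symm)

end StateExtension

/-! ### The canonical reduction and its section -/

namespace WedderburnDecomposition

variable {n ι : Type*} [Fintype n] [DecidableEq n]
  [Fintype ι] [DecidableEq ι] {s f : ι → Type*}
  [∀ ℓ, Fintype (s ℓ)] [∀ ℓ, DecidableEq (s ℓ)] [∀ ℓ, Fintype (f ℓ)] [∀ ℓ, DecidableEq (f ℓ)]
  {B : NonUnitalStarSubalgebra ℂ (Matrix n n ℂ)} (W : WedderburnDecomposition s f B)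

/-- The map `⨁ ℓ, b ℓ ↦ U (⨁ ℓ, b ℓ ⊗ 1) U†`, extended by zero outside the diagonal blocks. -/
def lift : Matrix (Σ ℓ, s ℓ) (Σ ℓ, s ℓ) ℂ →ₗ[ℂ] Matrix n n ℂ where
  -- Equality in `Σ ℓ, f ℓ` compares block and F-index at once, so off-diagonal blocks vanish. Being
  -- defined on all matrices, the map can serve as the dual of the partial traces.
  toFun y := W.U * (Matrix.of fun d d' : Σ ℓ, s ℓ × f ℓ =>
    if (⟨d.1, d.2.2⟩ : Σ ℓ, f ℓ) = ⟨d'.1, d'.2.2⟩ then y ⟨d.1, d.2.1⟩ ⟨d'.1, d'.2.1⟩ else 0) * W.Uᴴ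
  map_add' x y := by
    rw [← Matrix.add_mul, ← Matrix.mul_add]
    congr 2
    ext d d'
    simp [ite_add_ite]
  map_smul' c x := by
    rw [← Matrix.smul_mul, ← Matrix.mul_smul]
    congr 2
    ext d d'
    simp

theorem lift_apply (y : Matrix (Σ ℓ, s ℓ) (Σ ℓ, s ℓ) ℂ) :
    W.lift y = W.U * (Matrix.of fun d d' : Σ ℓ, s ℓ × f ℓ =>
      if (⟨d.1, d.2.2⟩ : Σ ℓ, f ℓ) = ⟨d'.1, d'.2.2⟩ then y ⟨d.1, d.2.1⟩ ⟨d'.1, d'.2.1⟩ else 0)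
        * W.Uᴴ :=
  rfl

theorem isCPMap_lift : Matrix.IsCPMap W.lift :=
  (Matrix.isCPMap_conj W.U).comp (Matrix.isCPMap_submatrix_fibre
    (fun d : Σ ℓ, s ℓ × f ℓ => (⟨d.1, d.2.1⟩ : Σ ℓ, s ℓ)) fun d => (⟨d.1, d.2.2⟩ : Σ ℓ, f ℓ))

theorem lift_blockDiagonal' (b : ∀ ℓ, Matrix (s ℓ) (s ℓ) ℂ) :
    W.lift (Matrix.blockDiagonal' b)
      = W.U * Matrix.blockDiagonal' (fun ℓ => b ℓ ⊗ₖ (1 : Matrix (f ℓ) (f ℓ) ℂ)) * W.Uᴴ := by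
  rw [lift_apply]
  congr 2
  ext ⟨ℓ, a, c⟩ ⟨ℓ', a', c'⟩
  by_cases h : ℓ = ℓ'
  · subst h
    simp [Matrix.blockDiagonal'_apply_eq, Matrix.one_apply]
  · simp [Matrix.blockDiagonal'_apply_ne _ _ _ h, h]

theorem lift_one : W.lift 1 = 1 := by
  rw [← Matrix.blockDiagonal'_one, lift_blockDiagonal']
  simp [← Pi.one_def, W.mul_conjTranspose_self]

theorem lift_blockDiagonal'_mem (b : ∀ ℓ, Matrix (s ℓ) (s ℓ) ℂ) :
    W.lift (Matrix.blockDiagonal' b) ∈ B :=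
  (W.mem_iff _).mpr ⟨b, W.lift_blockDiagonal' b⟩

theorem exists_eq_lift {X : Matrix n n ℂ} (hX : X ∈ B) : ∃ y, X = W.lift y := by
  obtain ⟨b, hb⟩ := (W.mem_iff X).mp hX
  exact ⟨_, hb.trans (W.lift_blockDiagonal' b).symm⟩

theorem trace_partialTraces_mul (X : Matrix n n ℂ) (y : Matrix (Σ ℓ, s ℓ) (Σ ℓ, s ℓ) ℂ) :
    ((W.partialTraces X)ᴴ * y).trace = (Xᴴ * W.lift y).trace := by
  have h : ∀ T : Matrix (Σ ℓ, s ℓ × f ℓ) (Σ ℓ, s ℓ × f ℓ) ℂ, (Xᴴ * (W.U * T * W.Uᴴ)).trace = ((W.Uᴴ * X * W.U)ᴴ * T).trace := by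
    intro T
    rw [← Matrix.mul_assoc, Matrix.trace_mul_comm]
    simp [Matrix.conjTranspose_mul, Matrix.mul_assoc]
  rw [lift_apply, h, partialTraces]
  generalize W.Uᴴ * X * W.U = Z
  simp only [Matrix.trace, Matrix.diag, Matrix.mul_apply, Matrix.conjTranspose_apply,
    Fintype.sum_sigma, Fintype.sum_prod_type, Matrix.of_apply]
  refine Finset.sum_congr rfl fun ℓ _ => Finset.sum_congr rfl fun b _ => ?_
  have hl : ∀ c : f ℓ, ∀ ℓ' ∈ Finset.univ, ℓ' ≠ ℓ → (∑ a : s ℓ', ∑ c' : f ℓ',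
      star (Z ⟨ℓ', (a, c')⟩ ⟨ℓ, (b, c)⟩) *
        if (⟨ℓ', c'⟩ : Σ ℓ, f ℓ) = ⟨ℓ, c⟩ then y ⟨ℓ', a⟩ ⟨ℓ, b⟩ else 0) = 0 := by
    intro c ℓ' _ hne
    simp [hne]
  rw [Finset.sum_eq_single ℓ (fun ℓ' _ hne => by simp [Matrix.blockDiagonal'_apply_ne _ _ _ hne])
    (by simp)]
  rw [Finset.sum_congr rfl fun c _ => Finset.sum_eq_single ℓ (hl c) (by simp), Finset.sum_comm]
  simp [Matrix.blockDiagonal'_apply_eq, Finset.sum_mul]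

theorem partialTraces_lift_blockDiagonal' (b : ∀ ℓ, Matrix (s ℓ) (s ℓ) ℂ) :
    W.partialTraces (W.lift (Matrix.blockDiagonal' b))
      = Matrix.blockDiagonal' fun ℓ => (Fintype.card (f ℓ) : ℂ) • b ℓ := by
  have h : ∀ T : Matrix (Σ ℓ, s ℓ × f ℓ) (Σ ℓ, s ℓ × f ℓ) ℂ, W.Uᴴ * (W.U * T * W.Uᴴ) * W.U = T := by
    intro T
    have := W.conjTranspose_mul_self
    calc _ = (W.Uᴴ * W.U) * T * (W.Uᴴ * W.U) := by simp only [Matrix.mul_assoc]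
      _ = T := by simp [this]
  rw [lift_blockDiagonal', partialTraces, h]
  congr 1
  ext ℓ i j
  simp [Matrix.blockDiagonal'_apply_eq]

/-- The partial traces as a linear map into the block diagonal algebra. -/
def reduction (A : NonUnitalStarSubalgebra ℂ (Matrix n n ℂ)) : A →ₗ[ℂ] blockAlgebra s where
  toFun X := ⟨W.partialTraces X, _, rfl⟩
  map_add' X Y := by
    apply Subtype.ext
    simp only [partialTraces, AddMemClass.coe_add, ← Matrix.blockDiagonal'_add]
    congr 1
    ext ℓ i j
    simp [Matrix.mul_add, Matrix.add_mul, Finset.sum_add_distrib]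
  map_smul' c X := by
    apply Subtype.ext
    simp only [partialTraces, SetLike.val_smul, RingHom.id_apply, ← Matrix.blockDiagonal'_smul]
    congr 1
    ext ℓ i j
    simp [Finset.mul_sum]

theorem isCPTP_reduction (A : NonUnitalStarSubalgebra ℂ (Matrix n n ℂ)) :
    IsCPTP (W.reduction A) := by
  refine ⟨.of_dual W.isCPMap_lift fun X y => W.trace_partialTraces_mul X y, fun X => ?_⟩
  have := W.trace_partialTraces_mul X 1
  rw [lift_one] at this
  simp only [Matrix.trace_conjTranspose, mul_one, star_inj] at this
  exact this

/-- The diagonal matrix with entry `(dim F_ℓ)^{-1/2}` on the `ℓ`-th block. -/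
noncomputable def weight (_W : WedderburnDecomposition s f B) : Matrix (Σ ℓ, s ℓ) (Σ ℓ, s ℓ) ℂ :=
  Matrix.diagonal fun q => ((√(Fintype.card (f q.1)) : ℝ) : ℂ)⁻¹

/-- Splitting the normalization into square roots makes it a conjugation, hence completely positive.
-/
theorem weight_mul_blockDiagonal'_mul (b : ∀ ℓ, Matrix (s ℓ) (s ℓ) ℂ) :
    W.weight * Matrix.blockDiagonal' b * W.weightᴴ
      = Matrix.blockDiagonal' fun ℓ => (Fintype.card (f ℓ) : ℂ)⁻¹ • b ℓ := by
  ext ⟨ℓ, a⟩ ⟨ℓ', a'⟩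
  by_cases h : ℓ = ℓ'
  · subst h
    have e : ((√(Fintype.card (f ℓ)) : ℝ) : ℂ) * ((√(Fintype.card (f ℓ)) : ℝ) : ℂ)
        = Fintype.card (f ℓ) := by
      rw [← Complex.ofReal_mul, Real.mul_self_sqrt (Nat.cast_nonneg _)]
      simp
    simp [weight, Matrix.diagonal_conjTranspose, Matrix.blockDiagonal'_apply_eq, ← e]
    ring
  · simp [weight, Matrix.diagonal_conjTranspose, Matrix.blockDiagonal'_apply_ne _ _ _ h]

/-- The section `⨁ ℓ, b ℓ ↦ U (⨁ ℓ, b ℓ ⊗ (dim F_ℓ)⁻¹ 1) U†` of the reduction by partial traces. -/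
noncomputable def injection {A : NonUnitalStarSubalgebra ℂ (Matrix n n ℂ)} (hBA : B ≤ A) :
    blockAlgebra s →ₗ[ℂ] A where
  toFun y := ⟨W.lift (W.weight * y * W.weightᴴ), by
    obtain ⟨_, b, rfl⟩ := y
    dsimp only
    rw [weight_mul_blockDiagonal'_mul]
    exact hBA (W.lift_blockDiagonal'_mem _)⟩
  map_add' x y := by
    apply Subtype.ext
    simp only [AddMemClass.coe_add, mul_add, add_mul, map_add]
  map_smul' c x := by
    apply Subtype.ext
    simp only [SetLike.val_smul, RingHom.id_apply, Matrix.mul_smul, Matrix.smul_mul, map_smul]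

variable {A : NonUnitalStarSubalgebra ℂ (Matrix n n ℂ)} (hBA : B ≤ A)

theorem injection_mem (y : blockAlgebra s) : (W.injection hBA y : Matrix n n ℂ) ∈ B := by
  obtain ⟨_, b, rfl⟩ := y
  change W.lift (W.weight * Matrix.blockDiagonal' b * W.weightᴴ) ∈ B
  rw [weight_mul_blockDiagonal'_mul]
  exact W.lift_blockDiagonal'_mem _

theorem reduction_injection (y : blockAlgebra s) : W.reduction A (W.injection hBA y) = y := by
  obtain ⟨_, b, rfl⟩ := y
  apply Subtype.ext
  change W.partialTraces (W.lift (W.weight * Matrix.blockDiagonal' b * W.weightᴴ)) = _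
  rw [weight_mul_blockDiagonal'_mul, partialTraces_lift_blockDiagonal']
  congr 1
  ext ℓ i j
  -- Nonzero F_ℓ makes dim F_ℓ invertible.
  have := W.nonempty_f ℓ
  simp

theorem isCPTP_injection : IsCPTP (W.injection hBA) := by
  refine ⟨.of_isCPMap (W.isCPMap_lift.comp (Matrix.isCPMap_conj W.weight)) fun _ => rfl,
    fun y => ?_⟩
  -- A section of a trace-preserving map preserves the trace.
  rw [← (W.isCPTP_reduction A).trace_preserving, reduction_injection]

variable {𝕁 : Module.End ℂ A}

theorem isCPTPFactorization (h : IsStateExtension A B 𝕁) :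
    IsCPTPFactorization 𝕁 (W.reduction A) (𝕁 ∘ₗ W.injection hBA) where
  reduction_cptp := W.isCPTP_reduction A
  injection_cptp := h.isCPTP.comp (W.isCPTP_injection hBA)
  factor := by
    ext1 X
    refine h.apply_congr fun b hb => ?_
    obtain ⟨y, rfl⟩ := W.exists_eq_lift hb
    rw [← trace_partialTraces_mul, ← trace_partialTraces_mul]
    have e := congrArg (Subtype.val) (W.reduction_injection hBA (W.reduction A X))
    exact congrArg (fun Z => (Zᴴ * y).trace) e.symm

theorem injective_comp_injection (h : IsStateExtension A B 𝕁) :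
    Function.Injective (𝕁 ∘ₗ W.injection hBA) := by
  rw [injective_iff_map_eq_zero]
  intro y hy
  rw [← W.reduction_injection hBA y, h.eq_zero_of_mem (W.injection_mem hBA y) hy, map_zero]

variable {R : A →ₗ[ℂ] blockAlgebra s} {J : blockAlgebra s →ₗ[ℂ] A}

-- The canonical `injection` serves only to show that 𝕁 has rank at least the dimension of the block
-- algebra, which leaves an arbitrary factorization through that algebra no slack.
include W in
theorem reduction_surjective_and_leftInverse (hBA : B ≤ A) (h : IsStateExtension A B 𝕁)
    (hRJ : IsCPTPFactorization 𝕁 R J) :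
    Function.Surjective R ∧ ∀ y, R (J y) = y := by
  have hi := W.injective_comp_injection hBA h
  rw [hRJ.factor, LinearMap.comp_assoc] at hi
  have hRS : Function.Surjective (R ∘ₗ W.injection hBA) :=
    LinearMap.injective_iff_surjective.mp (Function.Injective.of_comp hi)
  have hJ : Function.Injective J := by
    intro x y hxy
    obtain ⟨x, rfl⟩ := hRS x
    obtain ⟨y, rfl⟩ := hRS y
    rw [hi hxy]
  have hR : Function.Surjective R := Function.Surjective.of_comp hRS
  refine ⟨hR, fun y => ?_⟩
  obtain ⟨X, rfl⟩ := hR y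
  apply hJ
  have := h.apply_apply X
  rwa [hRJ.factor] at this

end WedderburnDecomposition

/-! ### Model reduction -/

theorem mainTheorem8 {n ι : Type*} [Fintype n] [DecidableEq n] [Fintype ι] [DecidableEq ι]
    {Y : Type*} [AddCommGroup Y] [Module ℂ Y]
    (M : QHM n Y)
    (B : NonUnitalStarSubalgebra ℂ (Matrix n n ℂ)) (hBA : B ≤ M.space)
    (s f : ι → Type*) [∀ ℓ, Fintype (s ℓ)] [∀ ℓ, DecidableEq (s ℓ)]
    [∀ ℓ, Fintype (f ℓ)] [∀ ℓ, DecidableEq (f ℓ)]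
    (W : WedderburnDecomposition s f B)
    (𝕁 : Module.End ℂ M.space) (h𝕁 : IsStateExtension M.space B 𝕁) :
    -- the canonical reduction is part of a CPTP factorization of the state extension
    (∃ (R : M.space →ₗ[ℂ] blockAlgebra s) (J : blockAlgebra s →ₗ[ℂ] M.space),
      (∀ X : M.space, (R X : Matrix (Σ ℓ, s ℓ) (Σ ℓ, s ℓ) ℂ) = W.partialTraces X) ∧
      IsCPTPFactorization 𝕁 R J) ∧
    -- every such factorization gives a solution of the model reduction problem
    ∀ (R : M.space →ₗ[ℂ] blockAlgebra s) (J : blockAlgebra s →ₗ[ℂ] M.space),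
      IsCPTPFactorization 𝕁 R J →
      (∀ ρ ∈ M.init, ∀ t : ℕ,
        M.out ((M.dyn ^ t) ρ) = M.out (𝕁 (((𝕁 * M.dyn * 𝕁) ^ t) (𝕁 ρ)))) →
      ∃ (M' : QHM (Σ ℓ, s ℓ) Y) (Φ : M.space →ₗ[ℂ] M'.space),
        (M'.space : Set (Matrix (Σ ℓ, s ℓ) (Σ ℓ, s ℓ) ℂ))
          = Set.range (fun X : M.space => (R X : Matrix (Σ ℓ, s ℓ) (Σ ℓ, s ℓ) ℂ)) ∧
        (∀ X : M.space, (Φ X : Matrix (Σ ℓ, s ℓ) (Σ ℓ, s ℓ) ℂ) = R X) ∧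
        (∀ x : M'.space, ∃ y : blockAlgebra s,
          (y : Matrix (Σ ℓ, s ℓ) (Σ ℓ, s ℓ) ℂ) = x ∧
          (M'.dyn x : Matrix (Σ ℓ, s ℓ) (Σ ℓ, s ℓ) ℂ) = R (M.dyn (J y)) ∧
          M'.out x = M.out (J y)) ∧
        M'.init = Φ '' M.init ∧
        SolvesReduction M M' Φ := by
  refine ⟨⟨W.reduction M.space, 𝕁 ∘ₗ W.injection hBA, fun _ => rfl,
    W.isCPTPFactorization hBA h𝕁⟩, fun R J hRJ hout => ?_⟩
  obtain ⟨hR, hRJ1⟩ := W.reduction_surjective_and_leftInverse hBA h𝕁 hRJ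
  have hJ (X : M.space) : 𝕁 X = J (R X) := by rw [hRJ.factor]; rfl
  -- R 𝕁 A 𝕁 = (R J) R A J R = (R A J) R.
  have hiter (t : ℕ) (X : M.space) :
      R (((𝕁 * M.dyn * 𝕁) ^ t) X) = ((R ∘ₗ M.dyn ∘ₗ J) ^ t) (R X) := by
    induction t generalizing X with
    | zero => rfl
    | succ t ih =>
      rw [pow_succ, pow_succ, Module.End.mul_apply, Module.End.mul_apply, ih]
      simp [hJ, hRJ1]
  have hsame : ∀ ρ ∈ M.init, ∀ t : ℕ,
      M.out ((M.dyn ^ t) ρ) = (M.out ∘ₗ J) (((R ∘ₗ M.dyn ∘ₗ J) ^ t) (R ρ)) := by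
    intro ρ hρ t
    rw [hout ρ hρ t, hJ (((𝕁 * M.dyn * 𝕁) ^ t) (𝕁 ρ)), hiter, hJ ρ, hRJ1]
    rfl
  -- Since R is onto, the block algebra itself is the image of R.
  refine ⟨{
      space := blockAlgebra s
      dyn := R ∘ₗ M.dyn ∘ₗ J
      dyn_cptp := hRJ.reduction_cptp.comp (M.dyn_cptp.comp hRJ.injection_cptp)
      out := M.out ∘ₗ J
      init := R '' M.init
      init_density := by
        rintro _ ⟨ρ, hρ, rfl⟩
        exact hRJ.reduction_cptp.isDensity (M.init_density ρ hρ) }, R, ?_, fun _ => rfl,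
    fun x => ⟨x, rfl, rfl, rfl⟩, rfl, ?_, hRJ.reduction_cptp, fun ρ hρ t => ?_⟩
  · ext x
    constructor
    · intro hx
      obtain ⟨X, hX⟩ := hR ⟨x, hx⟩
      exact ⟨X, congrArg Subtype.val hX⟩
    · rintro ⟨X, rfl⟩
      exact (R X).2
  · exact LinearMap.finrank_le_finrank_of_surjective hR
  · exact hsame ρ hρ t
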